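/- Channel I is the noiseless interference channel with two sender-receiver pairs in which, on each use, sender $i$ inputs a two-bit word $X_i$ and receiver $i$ obtains one bit $Y_i$ ($i=1,2$), where the output $Y_1Y_2$ is given by the following table (rows: $X_1$, columns: $X_2$). $$\begin{array}{c|cccc} X_1\backslash X_2 & 00 & 01 & 10 & 11\\ \hline 00 & 00 & 11 & 01 & 10\\ 01 & 11 & 00 & 10 & 01\\ 10 & 10 & 01 & 00 & 11\\ 11 & 01 & 10 & 11 & 00\end{array}$$ An entanglement-assisted $(2^{NR_1},2^{NR_2},N)$ code, $R_1,R_2\ge 0$, consists of: message sets of sizes $\lceil 2^{NR_1}\rceil$ and $\lceil 2^{NR_2}\rceil$; for some $n$, and for each of the $N$ channel uses, a bipartite pure state of dimension $2\times n$ shared by the two senders (either sender may hold the qubits); for each sender and each of her messages, a POVM with finitely many outcomes on all her shares of these $N$ states, and an encoding function that maps message and measurement outcome to a channel input word of length $N$; and for each receiver $i$ a decoding rule that maps his own output sequence $Y_i^N$ to an estimate of sender $i$'s message or to an error symbol. The rate pair $(R_1,R_2)$ is achievable if there is a sequence of such codes, $N=0,1,2,\dots$, for which the probability that the two estimates are not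 both correct, for independent uniformly distributed messages, tends to $0$ as $N\to\infty$. Let $C_{\mathrm{sum}}$ be the supremum of $R_1+R_2$ over all achievable rate pairs. Then $C_{\mathrm{sum}}<2$: if the senders share entanglement of dimension $2\times n$ (with any $n$), the sum capacity of Channel I is strictly less than $2$. -/

import Mathlib

open scoped Kronecker Matrix ComplexOrder

noncomputable section

/-- A two-bit channel input; the pair `(b, b')` is the word `bb'`. -/
abbrev Word2 : Type := Fin 2 × Fin 2

/-- Channel I: senders 1 and 2 put in two bits each, receiver 1 gets the first and receiver 2 the
second component of the output. -/
def channelI : Word2 → Word2 → Fin 2 × Fin 2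
  | (0, 0), (0, 0) => (0, 0)
  | (0, 0), (0, 1) => (1, 1)
  | (0, 0), (1, 0) => (0, 1)
  | (0, 0), (1, 1) => (1, 0)
  | (0, 1), (0, 0) => (1, 1)
  | (0, 1), (0, 1) => (0, 0)
  | (0, 1), (1, 0) => (1, 0)
  | (0, 1), (1, 1) => (0, 1)
  | (1, 0), (0, 0) => (1, 0)
  | (1, 0), (0, 1) => (0, 1)
  | (1, 0), (1, 0) => (0, 0)
  | (1, 0), (1, 1) => (1, 1)
  | (1, 1), (0, 0) => (0, 1)
  | (1, 1), (0, 1) => (1, 0)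
  | (1, 1), (1, 0) => (1, 1)
  | (1, 1), (1, 1) => (0, 0)

/-- A POVM with finite outcome set `O` on the Hilbert space `ℂ^ι`. -/
structure POVM (ι O : Type) [Fintype ι] [DecidableEq ι] [Fintype O] where
  /-- the effect (measurement operator) of each outcome -/
  effect : O → Matrix ι ι ℂ
  posSemidef : ∀ o, (effect o).PosSemidef
  sum_eq_one : ∑ o, effect o = 1

/-- Born rule for a bipartite measurement: `⟨Ψ| E ⊗ F |Ψ⟩`. -/
def bornProb {ι κ : Type} [Fintype ι] [Fintype κ] (Ψ : ι × κ → ℂ)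
    (E : Matrix ι ι ℂ) (F : Matrix κ κ ℂ) : ℝ :=
  (star Ψ ⬝ᵥ ((E ⊗ₖ F) *ᵥ Ψ)).re

/-- The tensor product `⨂ₖ Φₖ` of `N` bipartite vectors, with all first halves collected at
sender 1 and all second halves at sender 2. -/
def tensorState {N d₁ d₂ : ℕ} (Φ : Fin N → (Fin d₁ × Fin d₂ → ℂ)) :
    (Fin N → Fin d₁) × (Fin N → Fin d₂) → ℂ :=
  fun p => ∏ k, Φ k (p.1 k, p.2 k)

/-- An entanglement-assisted code for `N` uses of a channel with two-bit inputs and one-bit outputs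
for each of two sender-receiver pairs, with `M₁` messages for pair 1 and `M₂` messages for pair 2.
For every channel use the senders share a bipartite pure state of dimension `2 × n`
(either of them may hold the qubit). Depending on her message, each sender measures a
POVM on all of her shares, and maps message and outcome to a channel input word of length `N`.
Each receiver sees only his own output sequence, and returns an estimate of the message
of his sender or declares an error (`none`). -/
structure EACode (N M₁ M₂ : ℕ) where
  /-- local dimension at sender 1 -/
  d₁ : ℕ
  /-- local dimension at sender 2 -/
  d₂ : ℕ
  qubit : d₁ = 2 ∨ d₂ = 2
  /-- the shared state for each channel use -/
  Φ : Fin N → (Fin d₁ × Fin d₂ → ℂ)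
  norm_Φ : ∀ k, ∑ p, ‖Φ k p‖ ^ 2 = 1
  /-- number of outcomes of the measurements of sender 1 -/
  K₁ : ℕ
  /-- number of outcomes of the measurements of sender 2 -/
  K₂ : ℕ
  /-- choice of the POVM by sender 1 -/
  povm₁ : Fin M₁ → POVM (Fin N → Fin d₁) (Fin K₁)
  /-- choice of the POVM by sender 2 -/
  povm₂ : Fin M₂ → POVM (Fin N → Fin d₂) (Fin K₂)
  /-- encoding function of sender 1 -/
  enc₁ : Fin M₁ → Fin K₁ → (Fin N → Word2)
  /-- encoding function of sender 2 -/
  enc₂ : Fin M₂ → Fin K₂ → (Fin N → Word2)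
  /-- decoding rule of receiver 1 -/
  dec₁ : (Fin N → Fin 2) → Option (Fin M₁)
  /-- decoding rule of receiver 2 -/
  dec₂ : (Fin N → Fin 2) → Option (Fin M₂)

namespace EACode

variable {N M₁ M₂ : ℕ} (c : EACode N M₁ M₂)

/-- Probability of the measurement outcomes `(o₁, o₂)` given the messages `(m₁, m₂)`. -/
def outcomeProb (m₁ : Fin M₁) (m₂ : Fin M₂) (o₁ : Fin c.K₁) (o₂ : Fin c.K₂) : ℝ :=
  bornProb (tensorState c.Φ) ((c.povm₁ m₁).effect o₁) ((c.povm₂ m₂).effect o₂)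

/-- The estimates of the two receivers over Channel I, given messages and measurement outcomes. -/
def decoded (m₁ : Fin M₁) (m₂ : Fin M₂) (o₁ : Fin c.K₁) (o₂ : Fin c.K₂) :
    Option (Fin M₁) × Option (Fin M₂) :=
  (c.dec₁ fun k => (channelI (c.enc₁ m₁ o₁ k) (c.enc₂ m₂ o₂ k)).1,
   c.dec₂ fun k => (channelI (c.enc₁ m₁ o₁ k) (c.enc₂ m₂ o₂ k)).2)

/-- Error probability `P{(M̂₁, M̂₂) ≠ (M₁, M₂)}` over Channel I, for independent uniformly
distributed messages. -/
def errorProb : ℝ :=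
  (∑ m₁, ∑ m₂, ∑ o₁, ∑ o₂,
    if c.decoded m₁ m₂ o₁ o₂ = (some m₁, some m₂) then 0 else c.outcomeProb m₁ m₂ o₁ o₂)
    / ((M₁ : ℝ) * (M₂ : ℝ))

end EACode

/-- The rate pair `(R₁, R₂)` is achievable over Channel I if the senders share `2 × n`
entanglement: there is a sequence of `(2^{N R₁}, 2^{N R₂}, N)` codes with error probability
tending to zero. -/
def EAAchievable (R₁ R₂ : ℝ) : Prop :=
  0 ≤ R₁ ∧ 0 ≤ R₂ ∧
    ∃ c : (N : ℕ) → EACode N ⌈(2 : ℝ) ^ ((N : ℝ) * R₁)⌉₊ ⌈(2 : ℝ) ^ ((N : ℝ) * R₂)⌉₊,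
      Filter.Tendsto (fun N => (c N).errorProb) Filter.atTop (nhds 0)

/-- The sum capacity of Channel I (in bits per channel use) if the senders share `2 × n`
entanglement: the supremum of `R₁ + R₂` over all achievable rate pairs. -/
def eaSumCapacity : EReal :=
  sSup {s : EReal | ∃ R₁ R₂ : ℝ, EAAchievable R₁ R₂ ∧ s = ((R₁ + R₂ : ℝ) : EReal)}

end

/-! Put `a = w.1 + 2 * w.2` for the word of sender 1 and `b` likewise for sender 2. The output is
the unique `(y₁, y₂)` with `y₁ - y₂ + 2 y₁ y₂ = a - b` in `ℤ/4`. Since each output word fixes a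
decoded message, decoding turns into a CHSH-like game: the output words are the questions, and the
senders must answer with inputs that produce them. Expanding the indicator of this relation into
characters of `ℤ/4` (`channelI_indicator`) separates the senders. For `s ∈ (ℤ/4)^N` there remains a
bilinear form in vectors of the unit ball (`norm_sum_smul_effect_le`), whose kernel is a tensor
product of 2 × 2 matrices of norm 2 or √2 (`sum_norm_sq_prod_kernel_le`). Summing over `s` gives
`successSum_le`: `M₁ M₂ (1 - error) ≤ (2 + √2)^N`. Hence the sum rate is at most `log₂ (2 + √2) <
2`. -/

/-! ### Hilbert space inequalities for POVMs and tensor product kernels. -/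

section InnerProduct

variable {E : Type*} [NormedAddCommGroup E] [InnerProductSpace ℂ E]

/-- A combination of the effects of a POVM with phases as coefficients is a contraction. -/
theorem norm_sum_smul_effect_le {O : Type*} [Fintype O] (P : O → E →ₗ[ℂ] E)
    (hP : ∀ o, (P o).IsPositive) (hsum : ∑ o, P o = 1) (α : O → ℂ) (hα : ∀ o, ‖α o‖ = 1) (ψ : E) :
    ‖∑ o, α o • P o ψ‖ ≤ ‖ψ‖ := by
  set u := ∑ o, α o • P o ψ with hu
  -- Positivity of `P o` at `u - α o • ψ`. Summed over `o`, this reads `2‖u‖² ≤ ‖u‖² + ‖ψ‖²`.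
  have key : ∀ o, 2 * (α o * inner ℂ u (P o ψ)).re ≤
      (inner ℂ u (P o u)).re + (inner ℂ ψ (P o ψ)).re := by
    intro o
    have h := (hP o).re_inner_nonneg_right (u - α o • ψ)
    have hs : inner ℂ ψ (P o u) = (starRingEnd ℂ) (inner ℂ u (P o ψ)) := by
      rw [inner_conj_symm, (hP o).isSymmetric]
    have hn : α o * (starRingEnd ℂ) (α o) = 1 := by
      rw [Complex.mul_conj, Complex.normSq_eq_norm_sq, hα]; simp
    have h2 : inner ℂ (u - α o • ψ) (P o (u - α o • ψ)) =
        inner ℂ u (P o u) + inner ℂ ψ (P o ψ) - (α o * inner ℂ u (P o ψ)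
          + (starRingEnd ℂ) (α o * inner ℂ u (P o ψ))) := by
      simp only [map_sub, map_smul, inner_sub_left, inner_sub_right, inner_smul_left,
        inner_smul_right, hs, map_mul]
      linear_combination (inner ℂ ψ (P o ψ)) * hn
    rw [h2] at h
    simp only [RCLike.re_to_complex, Complex.sub_re, Complex.add_re, Complex.conj_re] at h
    linarith
  have hsumv : ∀ x : E, ∑ o, (inner ℂ x (P o x)).re = ‖x‖ ^ 2 := by
    intro x
    rw [← Complex.re_sum, ← inner_sum, ← LinearMap.sum_apply, hsum]
    simp [inner_self_eq_norm_sq_to_K, ← Complex.ofReal_pow]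
  have hself : ∑ o, (α o * inner ℂ u (P o ψ)).re = ‖u‖ ^ 2 := by
    rw [← Complex.re_sum]
    simp_rw [← inner_smul_right]
    rw [← inner_sum, ← hu]
    simp [inner_self_eq_norm_sq_to_K, ← Complex.ofReal_pow]
  have := Finset.sum_le_sum fun o (_ : o ∈ Finset.univ) => key o
  rw [← Finset.mul_sum, Finset.sum_add_distrib, hself, hsumv, hsumv] at this
  exact le_of_sq_le_sq (by linarith) (norm_nonneg _)

theorem sum_fin_succ_pi {A ι : Type*} [AddCommMonoid A] [Fintype ι] {N : ℕ}
    (f : (Fin (N + 1) → ι) → A) :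
    ∑ x, f x = ∑ a, ∑ t : Fin N → ι, f (Fin.cons a t) := by
  rw [← (Fin.consEquiv fun _ => ι).sum_comp, Fintype.sum_prod_type]
  rfl

/-- Bounds for the action of kernels on families of vectors multiply under tensor products. -/
theorem sum_norm_sq_prod_kernel_le {ι : Type*} [Fintype ι] {N : ℕ} (h : Fin N → ι → ι → ℂ)
    (c : Fin N → ℝ) (hc : ∀ k, 0 ≤ c k)
    (hh : ∀ k (v : ι → E), ∑ x, ‖∑ y, h k x y • v y‖ ^ 2 ≤ c k * ∑ y, ‖v y‖ ^ 2)
    (v : (Fin N → ι) → E) :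
    ∑ x : Fin N → ι, ‖∑ y : Fin N → ι, (∏ k, h k (x k) (y k)) • v y‖ ^ 2 ≤ (∏ k, c k) * ∑ y, ‖v y‖ ^ 2 := by
  induction N with
  | zero => simp
  | succ N ih =>
    rw [sum_fin_succ_pi, sum_fin_succ_pi (fun y => ‖v y‖ ^ 2)]
    -- The first tensor factor acts on the vectors already contracted over the other coordinates.
    calc _ = ∑ t : Fin N → ι, ∑ a, ‖∑ b, h 0 a b • ∑ t' : Fin N → ι,
              (∏ k : Fin N, h k.succ (t k) (t' k)) • v (Fin.cons b t')‖ ^ 2 := by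
          rw [Finset.sum_comm]
          refine Finset.sum_congr rfl fun t _ => Finset.sum_congr rfl fun a _ => ?_
          rw [sum_fin_succ_pi]
          simp [Fin.prod_univ_succ, Finset.smul_sum, smul_smul]
      _ ≤ ∑ t : Fin N → ι, c 0 * ∑ b, ‖∑ t' : Fin N → ι,
              (∏ k : Fin N, h k.succ (t k) (t' k)) • v (Fin.cons b t')‖ ^ 2 :=
          Finset.sum_le_sum fun t _ => hh 0 _
      _ = c 0 * ∑ b, ∑ t : Fin N → ι, ‖∑ t' : Fin N → ι,
              (∏ k : Fin N, h k.succ (t k) (t' k)) • v (Fin.cons b t')‖ ^ 2 := by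
          rw [← Finset.mul_sum, Finset.sum_comm]
      _ ≤ c 0 * ∑ b, (∏ k : Fin N, c k.succ) * ∑ t' : Fin N → ι, ‖v (Fin.cons b t')‖ ^ 2 := by
          refine mul_le_mul_of_nonneg_left (Finset.sum_le_sum fun b _ => ?_) (hc 0)
          exact ih (fun k => h k.succ) (fun k => c k.succ) (fun k => hc _) (fun k => hh _) _
      _ = _ := by rw [← Finset.mul_sum, Fin.prod_univ_succ, mul_assoc]

/-- The bilinear form of a kernel bounded by `C`, on families of vectors in the unit ball. -/
theorem norm_sum_kernel_inner_le {X : Type*} [Fintype X] (H : X → X → ℂ) {C : ℝ} (hC : 0 ≤ C)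
    (hH : ∀ v : X → E, ∑ x, ‖∑ y, H x y • v y‖ ^ 2 ≤ C ^ 2 * ∑ y, ‖v y‖ ^ 2)
    (u v : X → E) (hu : ∀ x, ‖u x‖ ≤ 1) (hv : ∀ x, ‖v x‖ ≤ 1) :
    ‖∑ x, ∑ y, H x y * inner ℂ (u x) (v y)‖ ≤ C * Fintype.card X := by
  have hball : ∀ w : X → E, (∀ x, ‖w x‖ ≤ 1) → ∑ x, ‖w x‖ ^ 2 ≤ Fintype.card X := by
    intro w hw
    calc _ ≤ ∑ _x : X, (1 : ℝ) :=
          Finset.sum_le_sum fun x _ => pow_le_one₀ (norm_nonneg _) (hw x)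
      _ = _ := by simp
  set w : X → E := fun x => ∑ y, H x y • v y with hw
  have h1 : ∑ x, ∑ y, H x y * inner ℂ (u x) (v y) = ∑ x, inner ℂ (u x) (w x) := by
    simp_rw [hw, inner_sum, inner_smul_right]
  have h2 : ‖∑ x, inner ℂ (u x) (w x)‖ ≤ ∑ x, ‖u x‖ * ‖w x‖ :=
    (norm_sum_le _ _).trans (Finset.sum_le_sum fun x _ => norm_inner_le_norm _ _)
  have h3 := Finset.sum_mul_sq_le_sq_mul_sq Finset.univ (fun x => ‖u x‖) (fun x => ‖w x‖)
  have h4 : ∑ x, ‖w x‖ ^ 2 ≤ C ^ 2 * Fintype.card X :=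
    (hH v).trans (mul_le_mul_of_nonneg_left (hball v hv) (sq_nonneg _))
  rw [h1]
  refine h2.trans (le_of_sq_le_sq (h3.trans ?_) (by positivity))
  calc _ ≤ (Fintype.card X : ℝ) * (C ^ 2 * Fintype.card X) :=
        mul_le_mul (hball u hu) h4 (Finset.sum_nonneg fun _ _ => sq_nonneg _) (by positivity)
    _ = _ := by ring

end InnerProduct

/-! ### Character expansion of Channel I. -/

noncomputable section

/-- The phase of sender 1 in the expansion of Channel I into characters of `ℤ/4`. -/
def phase₁ (s : Fin 4) (y : Fin 2) (w : Word2) : ℂ :=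
  Complex.I ^ (s.val * (3 * (w.1.val + 2 * w.2.val) + y.val))

/-- The phase of sender 2 in the expansion of Channel I into characters of `ℤ/4`. -/
def phase₂ (s : Fin 4) (y : Fin 2) (w : Word2) : ℂ :=
  Complex.I ^ (s.val * (w.1.val + 2 * w.2.val + 3 * y.val))

/-- The all-ones matrix for even `s`, and the CHSH matrix `(-1)^(xy)` for odd `s`. -/
def chshKernel (s : Fin 4) (x y : Fin 2) : ℂ := (-1) ^ (s.val * (x.val * y.val))

/-- The operator norm of `chshKernel s`. -/
def chshNorm (s : Fin 4) : ℝ := if s.val % 2 = 0 then 2 else √2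

theorem norm_phase₁ (s : Fin 4) (y : Fin 2) (w : Word2) : ‖phase₁ s y w‖ = 1 := by
  simp [phase₁]

theorem norm_phase₂ (s : Fin 4) (y : Fin 2) (w : Word2) : ‖phase₂ s y w‖ = 1 := by
  simp [phase₂]

theorem chshNorm_nonneg (s : Fin 4) : 0 ≤ chshNorm s := by
  unfold chshNorm; split_ifs <;> positivity

theorem sum_chshNorm : ∑ s, chshNorm s = 4 + 2 * √2 := by
  simp [Fin.sum_univ_four, chshNorm]; ring

/-- Channel I as a `ℤ/4`-valued CHSH relation, expanded into characters. -/
theorem channelI_indicator (w₁ w₂ : Word2) (y₁ y₂ : Fin 2) :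
    (if channelI w₁ w₂ = (y₁, y₂) then 1 else 0 : ℂ) =
      ∑ s, 4⁻¹ * (chshKernel s y₁ y₂ * (phase₁ s y₁ w₁ * phase₂ s y₂ w₂)) := by
  -- The CHSH sign is `I ^ (2 s y₁ y₂)`, so all factors merge into one power of `I`; reducing the
  -- exponent mod 4 keeps the case check small.
  have hexp : ∀ s : Fin 4, chshKernel s y₁ y₂ * (phase₁ s y₁ w₁ * phase₂ s y₂ w₂) =
      Complex.I ^ ((s.val * (2 * (y₁.val * y₂.val) + (3 * (w₁.1.val + 2 * w₁.2.val) + y₁.val)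
        + (w₂.1.val + 2 * w₂.2.val + 3 * y₂.val))) % 4) := by
    intro s
    rw [← Complex.I_pow_eq_pow_mod, chshKernel, phase₁, phase₂, ← Complex.I_sq, ← pow_mul,
      ← pow_add, ← pow_add]
    congr 1; ring
  simp_rw [hexp]
  obtain ⟨a, b⟩ := w₁
  obtain ⟨c, d⟩ := w₂
  fin_cases a <;> fin_cases b <;> fin_cases c <;> fin_cases d <;> fin_cases y₁ <;>
    fin_cases y₂ <;> norm_num [channelI, Fin.sum_univ_four, pow_succ, Complex.ext_iff]

/-- For odd `s` this is the parallelogram law, with equality; for even `s` the term `‖v 0 - v 1‖²`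
is dropped. -/
theorem chshKernel_bound {E : Type*} [NormedAddCommGroup E] [InnerProductSpace ℂ E]
    (s : Fin 4) (v : Fin 2 → E) :
    ∑ x, ‖∑ y, chshKernel s x y • v y‖ ^ 2 ≤ chshNorm s ^ 2 * ∑ y, ‖v y‖ ^ 2 := by
  have hp := parallelogram_law_with_norm ℂ (v 0) (v 1)
  have hm := mul_self_nonneg ‖v 0 - v 1‖
  fin_cases s <;> simp [Fin.sum_univ_two, chshKernel, chshNorm, ← sub_eq_add_neg, pow_succ] <;>
    nlinarith

theorem sum_norm_sq_tensorState {N d₁ d₂ : ℕ} (Φ : Fin N → (Fin d₁ × Fin d₂ → ℂ))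
    (hΦ : ∀ k, ∑ p, ‖Φ k p‖ ^ 2 = 1) : ∑ p, ‖tensorState Φ p‖ ^ 2 = 1 := by
  have h := Fintype.prod_sum fun k p => ‖Φ k p‖ ^ 2
  simp only [hΦ, Finset.prod_const_one] at h
  rw [h, ← (Equiv.arrowProdEquivProdArrow (Fin N) (fun _ => Fin d₁) (fun _ => Fin d₂)).sum_comp]
  simp [tensorState, Equiv.arrowProdEquivProdArrow, Finset.prod_pow]

theorem sum_comm_four {A α₁ α₂ α₃ α₄ γ : Type*} [AddCommMonoid A] [Fintype α₁] [Fintype α₂]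
    [Fintype α₃] [Fintype α₄] [Fintype γ] (f : α₁ → α₂ → α₃ → α₄ → γ → A) :
    ∑ a, ∑ b, ∑ c, ∑ d, ∑ y, f a b c d y = ∑ y, ∑ a, ∑ b, ∑ c, ∑ d, f a b c d y := by
  symm
  rw [Finset.sum_comm]
  refine Finset.sum_congr rfl fun a _ => ?_
  rw [Finset.sum_comm]
  refine Finset.sum_congr rfl fun b _ => ?_
  rw [Finset.sum_comm]
  refine Finset.sum_congr rfl fun c _ => ?_
  exact Finset.sum_comm

/-! ### Success probability of a code. -/

namespace EACode

variable {N M₁ M₂ : ℕ} (c : EACode N M₁ M₂)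

/-- The joint Hilbert space of the two senders. -/
abbrev JointSpace : Type := EuclideanSpace ℂ ((Fin N → Fin c.d₁) × (Fin N → Fin c.d₂))

/-- The shared state as a vector of the joint Hilbert space. -/
def state : c.JointSpace := WithLp.toLp 2 (tensorState c.Φ)

theorem norm_state : ‖c.state‖ = 1 := by
  rw [EuclideanSpace.norm_eq, state, sum_norm_sq_tensorState c.Φ c.norm_Φ, Real.sqrt_one]

/-- The effects of sender 1 on the joint Hilbert space. -/
def effect₁ (m : Fin M₁) (o : Fin c.K₁) : c.JointSpace →ₗ[ℂ] c.JointSpace :=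
  Matrix.toEuclideanLin ((c.povm₁ m).effect o ⊗ₖ 1)

/-- The effects of sender 2 on the joint Hilbert space. -/
def effect₂ (m : Fin M₂) (o : Fin c.K₂) : c.JointSpace →ₗ[ℂ] c.JointSpace :=
  Matrix.toEuclideanLin (1 ⊗ₖ (c.povm₂ m).effect o)

theorem effect₁_isPositive (m : Fin M₁) (o : Fin c.K₁) : (c.effect₁ m o).IsPositive :=
  Matrix.isPositive_toEuclideanLin_iff.2 (((c.povm₁ m).posSemidef o).kronecker .one)

theorem effect₂_isPositive (m : Fin M₂) (o : Fin c.K₂) : (c.effect₂ m o).IsPositive :=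
  Matrix.isPositive_toEuclideanLin_iff.2 (Matrix.PosSemidef.one.kronecker ((c.povm₂ m).posSemidef o))

theorem sum_effect₁ (m : Fin M₁) : ∑ o, c.effect₁ m o = 1 := by
  simp only [effect₁]
  rw [← map_sum]
  have : ∑ o, (c.povm₁ m).effect o ⊗ₖ (1 : Matrix (Fin N → Fin c.d₂) (Fin N → Fin c.d₂) ℂ) = 1 := by
    rw [← Matrix.one_kronecker_one, ← (c.povm₁ m).sum_eq_one]
    ext i j
    simp [Matrix.sum_apply, Finset.sum_mul]
  rw [this]
  ext v i
  simp

theorem sum_effect₂ (m : Fin M₂) : ∑ o, c.effect₂ m o = 1 := by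
  simp only [effect₂]
  rw [← map_sum]
  have : ∑ o, (1 : Matrix (Fin N → Fin c.d₁) (Fin N → Fin c.d₁) ℂ) ⊗ₖ (c.povm₂ m).effect o = 1 := by
    rw [← Matrix.one_kronecker_one, ← (c.povm₂ m).sum_eq_one]
    ext i j
    simp [Matrix.sum_apply, Finset.mul_sum]
  rw [this]
  ext v i
  simp

/-- Self-adjointness of `E ⊗ 1` moves it to the left argument, so each argument depends on one
sender only. -/
theorem outcomeProb_eq_inner (m₁ : Fin M₁) (m₂ : Fin M₂) (o₁ : Fin c.K₁) (o₂ : Fin c.K₂) :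
    c.outcomeProb m₁ m₂ o₁ o₂ =
      (inner ℂ (c.effect₁ m₁ o₁ c.state) (c.effect₂ m₂ o₂ c.state)).re := by
  rw [(c.effect₁_isPositive m₁ o₁).isSymmetric, outcomeProb, bornProb]
  have : (c.povm₁ m₁).effect o₁ ⊗ₖ (c.povm₂ m₂).effect o₂ =
      ((c.povm₁ m₁).effect o₁ ⊗ₖ 1) * (1 ⊗ₖ (c.povm₂ m₂).effect o₂) := by
    rw [← Matrix.mul_kronecker_mul, mul_one, one_mul]
  rw [this, ← Matrix.mulVec_mulVec, effect₁, effect₂, state, EuclideanSpace.inner_eq_star_dotProduct,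
    dotProduct_comm]
  rfl

theorem sum_outcomeProb (m₁ : Fin M₁) (m₂ : Fin M₂) :
    ∑ o₁, ∑ o₂, c.outcomeProb m₁ m₂ o₁ o₂ = 1 := by
  simp_rw [outcomeProb_eq_inner, ← Complex.re_sum, ← inner_sum, ← sum_inner, ← LinearMap.sum_apply,
    sum_effect₁, sum_effect₂]
  simp [inner_self_eq_norm_sq_to_K, norm_state]

/-- The sum over all pairs of messages of the probability of correct decoding. -/
def successSum : ℝ :=
  ∑ m₁, ∑ m₂, ∑ o₁, ∑ o₂,
    if c.decoded m₁ m₂ o₁ o₂ = (some m₁, some m₂) then c.outcomeProb m₁ m₂ o₁ o₂ else 0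

theorem successSum_eq (h₁ : 0 < M₁) (h₂ : 0 < M₂) :
    c.successSum = M₁ * M₂ * (1 - c.errorProb) := by
  have hM : (M₁ : ℝ) * M₂ ≠ 0 := by positivity
  rw [errorProb, mul_sub, mul_div_cancel₀ _ hM, mul_one, eq_sub_iff_add_eq, successSum]
  simp_rw [← Finset.sum_add_distrib]
  have : ∀ m₁ m₂ o₁ o₂,
      ((if c.decoded m₁ m₂ o₁ o₂ = (some m₁, some m₂) then c.outcomeProb m₁ m₂ o₁ o₂ else 0) +
        if c.decoded m₁ m₂ o₁ o₂ = (some m₁, some m₂) then 0 else c.outcomeProb m₁ m₂ o₁ o₂) =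
      c.outcomeProb m₁ m₂ o₁ o₂ := by
    intros; split_ifs <;> simp
  simp [this, sum_outcomeProb]

/-- For a character `s` and an output word `y` of receiver 1: the combination of the
post-measurement vectors of sender 1 for the message that `y` decodes to. -/
def vec₁ (s : Fin N → Fin 4) (y : Fin N → Fin 2) : c.JointSpace :=
  -- Output words decoded as errors contribute 0. The phase is conjugated because the inner product
  -- is conjugate-linear on the left.
  (c.dec₁ y).elim 0 fun m => ∑ o, (starRingEnd ℂ) (∏ k, phase₁ (s k) (y k) (c.enc₁ m o k)) •
    c.effect₁ m o c.state

/-- The analogue of `vec₁` for sender 2. -/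
def vec₂ (s : Fin N → Fin 4) (y : Fin N → Fin 2) : c.JointSpace :=
  (c.dec₂ y).elim 0 fun m => ∑ o, (∏ k, phase₂ (s k) (y k) (c.enc₂ m o k)) •
    c.effect₂ m o c.state

theorem norm_vec₁_le (s : Fin N → Fin 4) (y : Fin N → Fin 2) : ‖c.vec₁ s y‖ ≤ 1 := by
  rw [vec₁]
  cases c.dec₁ y with
  | none => simp
  | some m =>
    exact (norm_sum_smul_effect_le (c.effect₁ m) (c.effect₁_isPositive m) (c.sum_effect₁ m) _
      (fun o => by simp [norm_prod, norm_phase₁]) _).trans c.norm_state.le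

theorem norm_vec₂_le (s : Fin N → Fin 4) (y : Fin N → Fin 2) : ‖c.vec₂ s y‖ ≤ 1 := by
  rw [vec₂]
  cases c.dec₂ y with
  | none => simp
  | some m =>
    exact (norm_sum_smul_effect_le (c.effect₂ m) (c.effect₂_isPositive m) (c.sum_effect₂ m) _
      (fun o => by simp [norm_prod, norm_phase₂]) _).trans c.norm_state.le

theorem indicator_eq_sum_characters (w₁ w₂ : Fin N → Word2) (y₁ y₂ : Fin N → Fin 2) :
    (if ((fun k => (channelI (w₁ k) (w₂ k)).1) = y₁ ∧ (fun k => (channelI (w₁ k) (w₂ k)).2) = y₂)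
      then 1 else 0 : ℂ) =
    ∑ s : Fin N → Fin 4, (4 ^ N)⁻¹ * ((∏ k, chshKernel (s k) (y₁ k) (y₂ k)) *
      ((∏ k, phase₁ (s k) (y₁ k) (w₁ k)) * ∏ k, phase₂ (s k) (y₂ k) (w₂ k))) := by
  have h := Fintype.prod_sum fun (k : Fin N) (s : Fin 4) =>
    4⁻¹ * (chshKernel s (y₁ k) (y₂ k) * (phase₁ s (y₁ k) (w₁ k) * phase₂ s (y₂ k) (w₂ k)))
  simp_rw [← channelI_indicator, Finset.prod_mul_distrib] at h
  simp only [Finset.prod_const, Finset.card_univ, Fintype.card_fin, inv_pow] at h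
  rw [← h, Finset.prod_ite_zero]
  simp [funext_iff, Prod.ext_iff, forall_and]

/-- Sorting by output words leaves one message pair per `(y₁, y₂)`, so the sum no longer runs over
messages. -/
theorem successSum_eq_sum_outputs :
    c.successSum = (∑ y₁, ∑ y₂, (c.dec₁ y₁).elim 0 fun m₁ => (c.dec₂ y₂).elim 0 fun m₂ =>
      ∑ o₁, ∑ o₂,
        (if ((fun k => (channelI (c.enc₁ m₁ o₁ k) (c.enc₂ m₂ o₂ k)).1) = y₁ ∧
          (fun k => (channelI (c.enc₁ m₁ o₁ k) (c.enc₂ m₂ o₂ k)).2) = y₂) then 1 else 0) *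
        inner ℂ (c.effect₁ m₁ o₁ c.state) (c.effect₂ m₂ o₂ c.state) : ℂ).re := by
  set p : Fin M₁ → Fin M₂ → Fin c.K₁ → Fin c.K₂ → ℂ := fun m₁ m₂ o₁ o₂ =>
    inner ℂ (c.effect₁ m₁ o₁ c.state) (c.effect₂ m₂ o₂ c.state) with hp
  set I : Fin M₁ → Fin M₂ → Fin c.K₁ → Fin c.K₂ → (Fin N → Fin 2) → (Fin N → Fin 2) → ℂ :=
    fun m₁ m₂ o₁ o₂ y₁ y₂ =>
      if ((fun k => (channelI (c.enc₁ m₁ o₁ k) (c.enc₂ m₂ o₂ k)).1) = y₁ ∧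
        (fun k => (channelI (c.enc₁ m₁ o₁ k) (c.enc₂ m₂ o₂ k)).2) = y₂) then 1 else 0 with hI
  have hsum : ∀ m₁ m₂ o₁ o₂, (if c.decoded m₁ m₂ o₁ o₂ = (some m₁, some m₂) then
      c.outcomeProb m₁ m₂ o₁ o₂ else 0) = (∑ y₁, ∑ y₂, if c.dec₁ y₁ = some m₁ then
        if c.dec₂ y₂ = some m₂ then I m₁ m₂ o₁ o₂ y₁ y₂ * p m₁ m₂ o₁ o₂ else 0 else 0).re := by
    intro m₁ m₂ o₁ o₂
    rw [Fintype.sum_eq_single fun k => (channelI (c.enc₁ m₁ o₁ k) (c.enc₂ m₂ o₂ k)).1,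
      Fintype.sum_eq_single fun k => (channelI (c.enc₁ m₁ o₁ k) (c.enc₂ m₂ o₂ k)).2]
    · simp only [decoded, Prod.mk.injEq, ite_and, outcomeProb_eq_inner, hI, hp]
      split_ifs <;> simp
    · intro y hy
      simp [hI, hy.symm]
    · intro y hy
      simp [hI, hy.symm]
  simp_rw [successSum, hsum, ← Complex.re_sum]
  rw [sum_comm_four]
  simp_rw [sum_comm_four (γ := Fin N → Fin 2)]
  congr 1
  refine Finset.sum_congr rfl fun y₁ _ => Finset.sum_congr rfl fun y₂ _ => ?_
  cases c.dec₁ y₁ with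
  | none => simp
  | some m₁ =>
    cases c.dec₂ y₂ with
    | none => simp
    | some m₂ =>
      simp only [Option.some.injEq, Option.elim_some]
      rw [Fintype.sum_eq_single m₁ fun m hm => by simp [hm.symm],
        Fintype.sum_eq_single m₂ fun m hm => by simp [hm.symm]]
      simp [hI, hp]

theorem successSum_eq_characters :
    c.successSum = (∑ s : Fin N → Fin 4, (4 ^ N : ℂ)⁻¹ * ∑ y₁, ∑ y₂,
      (∏ k, chshKernel (s k) (y₁ k) (y₂ k)) * inner ℂ (c.vec₁ s y₁) (c.vec₂ s y₂)).re := by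
  rw [successSum_eq_sum_outputs]
  simp_rw [Finset.mul_sum]
  congr 1
  symm
  rw [Finset.sum_comm]
  refine Finset.sum_congr rfl fun y₁ _ => ?_
  rw [Finset.sum_comm]
  refine Finset.sum_congr rfl fun y₂ _ => ?_
  symm
  simp only [vec₁, vec₂]
  cases c.dec₁ y₁ with
  | none => simp
  | some m₁ =>
    cases c.dec₂ y₂ with
    | none => simp
    | some m₂ =>
      simp only [Option.elim_some, indicator_eq_sum_characters, sum_inner, inner_sum,
        inner_smul_left, inner_smul_right, Complex.conj_conj, Finset.sum_mul, Finset.mul_sum]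
      symm
      refine Eq.trans ?_ Finset.sum_comm
      refine Finset.sum_comm.trans (Finset.sum_congr rfl fun o₂ _ => ?_)
      refine Finset.sum_comm.trans (Finset.sum_congr rfl fun o₁ _ => ?_)
      refine Finset.sum_congr rfl fun s _ => ?_
      ring

theorem successSum_le : c.successSum ≤ (2 + √2) ^ N := by
  rw [successSum_eq_characters]
  -- The `2 ^ N` output words give the factor `2 ^ N`, against `4 ^ N` from the characters.
  have hbound : ∀ s : Fin N → Fin 4, ‖(4 ^ N : ℂ)⁻¹ * ∑ y₁, ∑ y₂,
      (∏ k, chshKernel (s k) (y₁ k) (y₂ k)) * inner ℂ (c.vec₁ s y₁) (c.vec₂ s y₂)‖ ≤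
      (2 ^ N)⁻¹ * ∏ k, chshNorm (s k) := by
    intro s
    have hH := norm_sum_kernel_inner_le (E := c.JointSpace)
      (fun y₁ y₂ : Fin N → Fin 2 => ∏ k, chshKernel (s k) (y₁ k) (y₂ k))
      (C := ∏ k, chshNorm (s k)) (Finset.prod_nonneg fun k _ => chshNorm_nonneg _)
      (fun v => by
        rw [← Finset.prod_pow]
        exact sum_norm_sq_prod_kernel_le (fun k => chshKernel (s k)) _ (fun _ => sq_nonneg _)
          (fun k v => chshKernel_bound (s k) v) v)
      (c.vec₁ s) (c.vec₂ s) (c.norm_vec₁_le s) (c.norm_vec₂_le s)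
    rw [norm_mul, norm_inv, norm_pow, Complex.norm_ofNat]
    calc _ ≤ (4 ^ N : ℝ)⁻¹ * ((∏ k, chshNorm (s k)) * Fintype.card (Fin N → Fin 2)) := by gcongr
      _ = _ := by
        have : (4 : ℝ) ^ N = 2 ^ N * 2 ^ N := by rw [← mul_pow]; norm_num
        simp only [Fintype.card_pi, Fintype.card_fin, Finset.prod_const, Finset.card_univ, this]
        push_cast
        field_simp
  refine (Complex.re_le_norm _).trans ((norm_sum_le _ _).trans
    ((Finset.sum_le_sum fun s _ => hbound s).trans_eq ?_))
  rw [← Finset.mul_sum, ← Fintype.prod_sum fun (_ : Fin N) s => chshNorm s, sum_chshNorm]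
  rw [Finset.prod_const, Finset.card_univ, Fintype.card_fin, ← inv_pow, ← mul_pow]
  congr 1; ring

end EACode

/-! ### From the one-shot bound to rates. -/

theorem two_rpow_le_of_achievable {R₁ R₂ : ℝ} (h : EAAchievable R₁ R₂) :
    (2 : ℝ) ^ (R₁ + R₂) ≤ 2 + √2 := by
  obtain ⟨-, -, c, hc⟩ := h
  by_contra! hlt
  have hpos : 0 < 2 + √2 := by positivity
  have hgrow := tendsto_pow_atTop_atTop_of_one_lt ((one_lt_div hpos).2 hlt)
  -- At error at most 1/2, `successSum_le` allows at most `2 (2 + √2)^N` message pairs; the growth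
  -- beyond a factor 2 contradicts this.
  obtain ⟨N, hN, hN2⟩ := ((hc.eventually_le_const (show (0 : ℝ) < 1 / 2 by norm_num)).and
    (hgrow.eventually_gt_atTop 2)).exists
  have hM : ∀ R : ℝ, 0 < ⌈(2 : ℝ) ^ ((N : ℝ) * R)⌉₊ := fun R => Nat.ceil_pos.2 (by positivity)
  have hs := (c N).successSum_le
  rw [(c N).successSum_eq (hM _) (hM _)] at hs
  rw [div_pow, lt_div_iff₀ (by positivity), ← Real.rpow_mul_natCast (by norm_num)] at hN2
  have hle : (2 : ℝ) ^ ((R₁ + R₂) * N) ≤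
      (⌈(2 : ℝ) ^ ((N : ℝ) * R₁)⌉₊ : ℝ) * ⌈(2 : ℝ) ^ ((N : ℝ) * R₂)⌉₊ := by
    rw [show (R₁ + R₂) * N = N * R₁ + N * R₂ by ring, Real.rpow_add (by norm_num)]
    exact mul_le_mul (Nat.le_ceil _) (Nat.le_ceil _) (by positivity) (by positivity)
  have hMM : (0 : ℝ) ≤ (⌈(2 : ℝ) ^ ((N : ℝ) * R₁)⌉₊ : ℝ) * ⌈(2 : ℝ) ^ ((N : ℝ) * R₂)⌉₊ := by
    positivity
  nlinarith [mul_le_mul_of_nonneg_left (show (1 / 2 : ℝ) ≤ 1 - (c N).errorProb by linarith) hMM]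

theorem lemma3 : eaSumCapacity < 2 := by
  have hlog : Real.logb 2 (2 + √2) < 2 := by
    rw [Real.logb_lt_iff_lt_rpow (by norm_num) (by positivity)]
    have : √2 < 2 := by rw [Real.sqrt_lt' (by norm_num)]; norm_num
    norm_num; linarith
  refine lt_of_le_of_lt (b := ((Real.logb 2 (2 + √2) : ℝ) : EReal)) (sSup_le ?_)
    (EReal.coe_lt_coe_iff.2 hlog)
  rintro _ ⟨R₁, R₂, h, rfl⟩
  rw [EReal.coe_le_coe_iff, Real.le_logb_iff_rpow_le (by norm_num) (by positivity)]
  exact two_rpow_le_of_achievable h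

end
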